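/- Let $\Gamma$ be a finite simple graph with vertex set $V$ and edge set $E$, and let $C_\Gamma=\langle V \mid v^2=1\ \forall v\in V,\ uv=vu\ \forall\{u,v\}\in E\rangle$ be the associated right-angled Coxeter group. The geodesic growth series of $C_\Gamma$ with respect to $V$ is $$\mathcal G(z)=\sum_{k\ge 0}\#\{w\in V^k : w \text{ is geodesic}\}\,z^k\in\mathbb Z[[z]],$$ where a word $w$ in the letters $V$ is geodesic if no shorter word represents the same element of $C_\Gamma$. The link of a clique $\sigma$ of $\Gamma$ is the set of vertices outside $\sigma$ that are adjacent to every vertex of $\sigma$, and $\Gamma$ is link-regular if the number of vertices in the link of a clique depends only on the number of vertices of the clique. Theorem. Suppose that $\Gamma$ is link-regular, has $n$ vertices, is $l$-regular, has no $4$-cliques, and that the link of every edge has $q$ vertices (equivalently, every edge lies in exactly $q$ triangles). Then $$\mathcal G(z)-1=\frac{nz\bigl(1+(5-l-q)z+(lq-3l+6)z^2\bigr)}{1+(6-n-l-q)z+(nl+lq+qn-5n-3l-q+11)z^2+(3nl+6-nlq-6n)z^3},$$ where the right-hand side is a quotient in $\mathbb Z[[z]]$; its denominator is invertible there, having constant term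 $1$. -/

import Mathlib

namespace RACG

section Growth

variable {X G : Type*} [Group G]

/-- For a map `s : X → G` (a generating set indexed by the alphabet `X`), a word `w` in the letters
`X` is geodesic if no word with the same value in `G` is shorter. -/
def IsGeodesic (s : X → G) (w : List X) : Prop :=
  ∀ u : List X, (u.map s).prod = (w.map s).prod → w.length ≤ u.length

/-- The geodesic growth series: the coefficient of `z ^ k` is the number of geodesic words of
length `k` (a finite number when the alphabet is finite). -/
noncomputable def geodesicGrowthSeries (s : X → G) : PowerSeries ℤ :=
  PowerSeries.mk fun k => (({w : List X | w.length = k ∧ IsGeodesic s w}.ncard : ℕ) : ℤ)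

end Growth

/-- The indeterminate of `ℤ⟦z⟧`. -/
noncomputable abbrev z : PowerSeries ℤ := PowerSeries.X

section Graph

variable {V : Type*} (Γ : SimpleGraph V)

/-- The relators `v ^ 2` for all vertices `v`, and `u v u⁻¹ v⁻¹` for all edges `{u, v}`. -/
def relators : Set (FreeGroup V) :=
  {r | ∃ v : V, r = FreeGroup.of v ^ 2} ∪
    {r | ∃ u v : V, Γ.Adj u v ∧
      r = FreeGroup.of u * FreeGroup.of v * (FreeGroup.of u)⁻¹ * (FreeGroup.of v)⁻¹}

/-- The right-angled Coxeter group `⟨V ∣ v² = 1 for all v, uv = vu for all edges {u, v}⟩`. -/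
abbrev RightAngledCoxeterGroup : Type _ := PresentedGroup (relators Γ)

/-- The standard generators of the right-angled Coxeter group, indexed by the vertices. -/
def standardGenerator (v : V) : RightAngledCoxeterGroup Γ := PresentedGroup.of v

/-- The link of a set `σ` of vertices: the vertices outside `σ` adjacent to every vertex of `σ`. -/
def link (σ : Finset V) : Set V :=
  {v | v ∉ σ ∧ ∀ u ∈ σ, Γ.Adj u v}

/-- The number of vertices in the link of a clique depends only on the size of the clique. -/
def IsLinkRegular : Prop :=
  ∀ σ τ : Finset V, Γ.IsClique (σ : Set V) → Γ.IsClique (τ : Set V) → σ.card = τ.card →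
    (link Γ σ).ncard = (link Γ τ).ncard

end Graph

end RACG

/-! A word is geodesic exactly when no letter cancels against its suffix (Tits' solution of the word
problem): the group acts on reduced words up to commutation, and acting on the empty word recovers
the class of a reduced word. The letters of a reduced word `w` that can be moved to the front form a
clique `L`, and `v :: w` is reduced iff `v ∉ L`; its front letters are then `v` and the neighbours
of `v` in `L`. Put `t = |L| - 1`. Double counting edges and triangles on `L` expresses the sums of
`1`, `t` and `t(t-1)` over all extensions of `w` through the same three quantities for `w`. The
recursion closes because `t ≤ 2` when there are no 4-cliques. Solving the resulting 3×3 linear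
system of series gives the formula. -/

namespace RACG

/-! ### Word problem: geodesic words are the reduced words -/

section Words

variable {V : Type*} [DecidableEq V] (Γ : SimpleGraph V) [DecidableRel Γ.Adj]

/-- Equality of words up to exchanging neighbouring letters that are adjacent in `Γ`. -/
inductive TraceEq : List V → List V → Prop
  | refl (w : List V) : TraceEq w w
  | cons (x : V) {w w' : List V} : TraceEq w w' → TraceEq (x :: w) (x :: w')
  | swap {x y : V} (w : List V) : Γ.Adj x y → TraceEq (x :: y :: w) (y :: x :: w)
  | trans {u v w : List V} : TraceEq u v → TraceEq v w → TraceEq u w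

/-- Delete the first occurrence of `v` if it can be moved to the front by commutations. -/
def cancel (v : V) : List V → Option (List V)
  | [] => none
  | x :: w => if x = v then some w else if Γ.Adj x v then (cancel v w).map (x :: ·) else none

/-- Multiply a word by `v` on the left, cancelling if possible. -/
def act (v : V) (w : List V) : List V := (cancel Γ v w).getD (v :: w)

/-- A word is reduced if no letter cancels against the part of the word following it. -/
def IsReduced : List V → Prop
  | [] => True
  | v :: w => cancel Γ v w = none ∧ IsReduced w

variable {Γ}

omit [DecidableEq V] [DecidableRel Γ.Adj] in
theorem TraceEq.symm {w w' : List V} (h : TraceEq Γ w w') : TraceEq Γ w' w := by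
  induction h with
  | refl w => exact .refl w
  | cons x _ ih => exact .cons x ih
  | swap w h => exact .swap w h.symm
  | trans _ _ ih₁ ih₂ => exact .trans ih₂ ih₁

omit [DecidableEq V] [DecidableRel Γ.Adj] in
theorem TraceEq.length_eq {w w' : List V} (h : TraceEq Γ w w') : w.length = w'.length := by
  induction h with
  | refl w => rfl
  | cons x _ ih => simp [ih]
  | swap w h => rfl
  | trans _ _ ih₁ ih₂ => exact ih₁.trans ih₂

theorem cancel_self (v : V) (w : List V) : cancel Γ v (v :: w) = some w := by simp [cancel]

theorem cancel_cons_of_adj {x v : V} (h : Γ.Adj x v) (w : List V) :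
    cancel Γ v (x :: w) = (cancel Γ v w).map (x :: ·) := by simp [cancel, h, h.ne]

/-- Makes cancellation well defined on commutation classes; everything about the action rests on
this. -/
theorem TraceEq.cancel_rel {w w' : List V} (h : TraceEq Γ w w') (v : V) :
    Option.Rel (TraceEq Γ) (cancel Γ v w) (cancel Γ v w') := by
  induction h with
  | refl w => cases cancel Γ v w <;> constructor; exact .refl _
  | @cons x w w' h ih =>
    unfold cancel
    split_ifs
    · exact .some h
    · generalize cancel Γ v w = a at ih
      generalize cancel Γ v w' = b at ih
      cases ih with
      | some h => exact .some (.cons x h)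
      | none => exact .none
    · exact .none
  | @swap x y w h =>
    by_cases hx : x = v
    · subst hx
      rw [cancel_self, cancel_cons_of_adj h.symm, cancel_self]
      exact .some (.refl _)
    by_cases hy : y = v
    · subst hy
      rw [cancel_self, cancel_cons_of_adj h, cancel_self]
      exact .some (.refl _)
    simp only [cancel, if_neg hx, if_neg hy]
    cases cancel Γ v w <;> split_ifs <;> constructor
    exact .swap _ h
  | @trans a b c _ _ ih₁ ih₂ =>
    generalize cancel Γ v a = a at ih₁
    generalize cancel Γ v b = b at ih₁ ih₂
    generalize cancel Γ v c = c at ih₂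
    cases ih₁ with
    | none => exact ih₂
    | some h₁ => cases ih₂ with
      | some h₂ => exact .some (.trans h₁ h₂)

theorem TraceEq.cancel_eq_none {w w' : List V} (h : TraceEq Γ w w') {v : V}
    (hw : cancel Γ v w = none) : cancel Γ v w' = none := by
  have := h.cancel_rel v
  rw [hw] at this
  generalize cancel Γ v w' = b at this
  cases this
  rfl

theorem TraceEq.exists_cancel_eq_some {w w' u : List V} (h : TraceEq Γ w w') {v : V}
    (hw : cancel Γ v w = some u) : ∃ u', cancel Γ v w' = some u' ∧ TraceEq Γ u u' := by
  have := h.cancel_rel v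
  rw [hw] at this
  generalize cancel Γ v w' = b at this
  cases this with
  | some h => exact ⟨_, rfl, h⟩

theorem traceEq_of_cancel_eq_some {v : V} : ∀ {w u : List V}, cancel Γ v w = some u →
    TraceEq Γ w (v :: u)
  | [], u, h => by simp [cancel] at h
  | x :: w, u, h => by
    unfold cancel at h
    split_ifs at h with h₁ h₂
    · cases h
      subst h₁
      exact .refl _
    · obtain ⟨u', hu', rfl⟩ := Option.map_eq_some_iff.1 h
      exact (TraceEq.cons x (traceEq_of_cancel_eq_some hu')).trans (.swap u' h₂)

theorem TraceEq.isReduced {w w' : List V} (h : TraceEq Γ w w') (hw : IsReduced Γ w) :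
    IsReduced Γ w' := by
  induction h with
  | refl w => exact hw
  | cons x h ih => exact ⟨h.cancel_eq_none hw.1, ih hw.2⟩
  | @swap x y w h =>
    obtain ⟨h₁, h₂, h₃⟩ := hw
    rw [cancel_cons_of_adj h.symm, Option.map_eq_none_iff] at h₁
    refine ⟨?_, h₁, h₃⟩
    rw [cancel_cons_of_adj h, h₂, Option.map_none]
  | trans _ _ ih₁ ih₂ => exact ih₂ (ih₁ hw)

theorem act_of_cancel_eq_none {v : V} {w : List V} (h : cancel Γ v w = none) :
    act Γ v w = v :: w := by simp [act, h]

theorem act_of_cancel_eq_some {v : V} {w u : List V} (h : cancel Γ v w = some u) :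
    act Γ v w = u := by simp [act, h]

theorem TraceEq.act {w w' : List V} (h : TraceEq Γ w w') (v : V) :
    TraceEq Γ (act Γ v w) (act Γ v w') := by
  rcases hw : cancel Γ v w with _ | u
  · rw [act_of_cancel_eq_none hw, act_of_cancel_eq_none (h.cancel_eq_none hw)]
    exact .cons v h
  · obtain ⟨u', hu', huu'⟩ := h.exists_cancel_eq_some hw
    rwa [act_of_cancel_eq_some hw, act_of_cancel_eq_some hu']

theorem IsReduced.act {w : List V} (hw : IsReduced Γ w) (v : V) : IsReduced Γ (act Γ v w) := by
  rcases h : cancel Γ v w with _ | u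
  · rw [act_of_cancel_eq_none h]
    exact ⟨h, hw⟩
  · rw [act_of_cancel_eq_some h]
    exact ((traceEq_of_cancel_eq_some h).isReduced hw).2

theorem act_act_self {w : List V} (hw : IsReduced Γ w) (v : V) :
    TraceEq Γ (act Γ v (act Γ v w)) w := by
  rcases h : cancel Γ v w with _ | u
  · rw [act_of_cancel_eq_none h, act_of_cancel_eq_some (cancel_self v w)]
    exact .refl w
  · have hu := traceEq_of_cancel_eq_some h
    -- `v :: u` is equivalent to the reduced word `w`, so `v` cannot cancel again in `u`.
    rw [act_of_cancel_eq_some h, act_of_cancel_eq_none (hu.isReduced hw).1]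
    exact hu.symm

theorem act_comm_of_cancel_eq_some {u v : V} (huv : Γ.Adj u v) {w w₁ : List V}
    (hv : cancel Γ v w = some w₁) : TraceEq Γ (act Γ u (act Γ v w)) (act Γ v (act Γ u w)) := by
  have h₁ := traceEq_of_cancel_eq_some hv
  rw [act_of_cancel_eq_some hv]
  rcases hu : cancel Γ u w with _ | w₂
  · have h₂ := h₁.cancel_eq_none hu
    rw [cancel_cons_of_adj huv.symm, Option.map_eq_none_iff] at h₂
    have h₃ : cancel Γ v (u :: w) = some (u :: w₁) := by simp [cancel_cons_of_adj huv, hv]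
    rw [act_of_cancel_eq_none hu, act_of_cancel_eq_none h₂, act_of_cancel_eq_some h₃]
    exact .refl _
  · obtain ⟨w₃, h₃, h₂₃⟩ := h₁.exists_cancel_eq_some hu
    rw [cancel_cons_of_adj huv.symm] at h₃
    obtain ⟨w₄, h₄, rfl⟩ := Option.map_eq_some_iff.1 h₃
    obtain ⟨w₅, h₅, h₄₅⟩ := h₂₃.symm.exists_cancel_eq_some (cancel_self v w₄)
    rwa [act_of_cancel_eq_some hu, act_of_cancel_eq_some h₄, act_of_cancel_eq_some h₅]

theorem act_comm {u v : V} (huv : Γ.Adj u v) (w : List V) :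
    TraceEq Γ (act Γ u (act Γ v w)) (act Γ v (act Γ u w)) := by
  rcases hv : cancel Γ v w with _ | w₁
  · rcases hu : cancel Γ u w with _ | w₂
    · have h₁ : cancel Γ v (u :: w) = none := by simp [cancel_cons_of_adj huv, hv]
      have h₂ : cancel Γ u (v :: w) = none := by simp [cancel_cons_of_adj huv.symm, hu]
      rw [act_of_cancel_eq_none hv, act_of_cancel_eq_none hu, act_of_cancel_eq_none h₁,
        act_of_cancel_eq_none h₂]
      exact .swap w huv
    · exact (act_comm_of_cancel_eq_some huv.symm hu).symm
  · exact act_comm_of_cancel_eq_some huv hv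

theorem length_act_le (v : V) (w : List V) : (act Γ v w).length ≤ w.length + 1 := by
  rcases h : cancel Γ v w with _ | u
  · simp [act_of_cancel_eq_none h]
  · have := (traceEq_of_cancel_eq_some h).length_eq
    rw [act_of_cancel_eq_some h]
    simp at this
    omega

variable (Γ)

/-- Reduced words up to commutations. -/
def reducedTraceSetoid : Setoid {w : List V // IsReduced Γ w} where
  r w w' := TraceEq Γ w.1 w'.1
  iseqv := ⟨fun w => .refl w.1, fun h => h.symm, fun h₁ h₂ => h₁.trans h₂⟩

/-- The set of reduced words up to commutations. -/
abbrev ReducedTrace : Type _ := Quotient (reducedTraceSetoid Γ)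

/-- The action of a generator on the reduced words up to commutations. -/
def ReducedTrace.act (v : V) : ReducedTrace Γ → ReducedTrace Γ :=
  Quotient.map' (s₁ := reducedTraceSetoid Γ) (s₂ := reducedTraceSetoid Γ)
    (fun w => ⟨RACG.act Γ v w.1, w.2.act v⟩) fun _ _ h => TraceEq.act h v

theorem ReducedTrace.act_involutive (v : V) : Function.Involutive (ReducedTrace.act Γ v) := by
  intro x
  induction x using Quotient.inductionOn with
  | h w => exact Quotient.sound (s := reducedTraceSetoid Γ) (act_act_self w.2 v)

/-- The action of the right-angled Coxeter group on the reduced words up to commutations. -/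
def reducedTraceAction : RightAngledCoxeterGroup Γ →* Equiv.Perm (ReducedTrace Γ) :=
  PresentedGroup.toGroup (f := fun v => (ReducedTrace.act_involutive Γ v).toPerm) <| by
    rintro r (⟨v, rfl⟩ | ⟨u, v, huv, rfl⟩)
    · ext x
      simpa [pow_two] using ReducedTrace.act_involutive Γ v x
    · simp only [map_mul, map_inv, FreeGroup.lift_apply_of]
      rw [mul_inv_eq_one, mul_inv_eq_iff_eq_mul]
      ext x
      induction x using Quotient.inductionOn with
      | h w => exact Quotient.sound (s := reducedTraceSetoid Γ) (act_comm huv w.1)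

/-- The image of a word under successive left multiplications of its letters on the empty word. -/
def normalize (w : List V) : List V := w.foldr (act Γ) []

variable {Γ}

theorem isReduced_normalize : ∀ w : List V, IsReduced Γ (normalize Γ w)
  | [] => trivial
  | v :: w => (isReduced_normalize w).act v

theorem length_normalize_le : ∀ w : List V, (normalize Γ w).length ≤ w.length
  | [] => le_rfl
  | v :: w => (length_act_le v _).trans (Nat.succ_le_succ (length_normalize_le w))

theorem IsReduced.normalize_eq : ∀ {w : List V}, IsReduced Γ w → normalize Γ w = w
  | [], _ => rfl
  | v :: w, h => by
    change RACG.act Γ v (normalize Γ w) = v :: w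
    rw [normalize_eq h.2, act_of_cancel_eq_none h.1]

theorem reducedTraceAction_prod : ∀ w : List V,
    reducedTraceAction Γ (w.map (standardGenerator Γ)).prod
      (Quotient.mk (reducedTraceSetoid Γ) ⟨[], trivial⟩) =
      Quotient.mk (reducedTraceSetoid Γ) ⟨normalize Γ w, isReduced_normalize w⟩
  | [] => by simp [normalize]
  | v :: w => by
    rw [List.map_cons, List.prod_cons, map_mul, Equiv.Perm.mul_apply, reducedTraceAction_prod w]
    simp only [reducedTraceAction, standardGenerator, PresentedGroup.toGroup.of]
    rfl

/-- Words with equal value move the empty word to the same class, and normalizing fixes `w` and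
never lengthens `u`. -/
theorem IsReduced.isGeodesic {w : List V} (hw : IsReduced Γ w) :
    IsGeodesic (standardGenerator Γ) w := by
  intro u hu
  have h := reducedTraceAction_prod (Γ := Γ) u
  rw [hu, reducedTraceAction_prod] at h
  have h' : TraceEq Γ (normalize Γ w) (normalize Γ u) :=
    Quotient.exact (s := reducedTraceSetoid Γ) h
  rw [hw.normalize_eq] at h'
  exact h'.length_eq.trans_le (length_normalize_le u)

omit [DecidableEq V] [DecidableRel Γ.Adj] in
theorem standardGenerator_mul_self (v : V) :
    standardGenerator Γ v * standardGenerator Γ v = 1 := by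
  rw [← pow_two]
  exact PresentedGroup.one_of_mem (Or.inl ⟨v, rfl⟩)

omit [DecidableEq V] [DecidableRel Γ.Adj] in
theorem standardGenerator_mul_comm {u v : V} (h : Γ.Adj u v) :
    standardGenerator Γ u * standardGenerator Γ v =
      standardGenerator Γ v * standardGenerator Γ u := by
  have := PresentedGroup.one_of_mem (rels := relators Γ) (Or.inr ⟨u, v, h, rfl⟩)
  simp only [map_mul, map_inv] at this
  rw [mul_inv_eq_one, mul_inv_eq_iff_eq_mul] at this
  exact this

omit [DecidableEq V] [DecidableRel Γ.Adj] in
theorem TraceEq.prod_eq {w w' : List V} (h : TraceEq Γ w w') :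
    (w.map (standardGenerator Γ)).prod = (w'.map (standardGenerator Γ)).prod := by
  induction h with
  | refl w => rfl
  | cons x _ ih => simp [ih]
  | swap w h => simp [← mul_assoc, standardGenerator_mul_comm h]
  | trans _ _ ih₁ ih₂ => exact ih₁.trans ih₂

theorem isReduced_of_isGeodesic : ∀ {w : List V}, IsGeodesic (standardGenerator Γ) w →
    IsReduced Γ w
  | [], _ => trivial
  | v :: w, h => by
    refine ⟨?_, isReduced_of_isGeodesic fun u hu => ?_⟩
    · by_contra hne
      obtain ⟨u, hu⟩ := Option.ne_none_iff_exists'.1 hne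
      have hwu := traceEq_of_cancel_eq_some hu
      have h₁ := h u (by
        rw [List.map_cons, List.prod_cons, hwu.prod_eq, List.map_cons, List.prod_cons,
          ← mul_assoc, standardGenerator_mul_self, one_mul])
      have h₂ := hwu.length_eq
      simp at h₁ h₂
      omega
    -- A shorter word for the tail would give a shorter word for the whole.
    · simpa using h (v :: u) (by simp [hu])

theorem isGeodesic_iff_isReduced {w : List V} :
    IsGeodesic (standardGenerator Γ) w ↔ IsReduced Γ w :=
  ⟨isReduced_of_isGeodesic, IsReduced.isGeodesic⟩

variable (Γ)

/-- The letters of a word that can be moved to the front by commutations. -/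
def leftDescents : List V → Finset V
  | [] => ∅
  | x :: w => insert x ((leftDescents w).filter (Γ.Adj x))

variable {Γ}

theorem cancel_eq_none_iff {v : V} : ∀ {w : List V},
    cancel Γ v w = none ↔ v ∉ leftDescents Γ w
  | [] => by simp [cancel, leftDescents]
  | x :: w => by
    have ih := cancel_eq_none_iff (v := v) (w := w)
    unfold cancel leftDescents
    split_ifs with h₁ h₂
    · simp [h₁]
    · simp [ih, h₂, Ne.symm h₁]
    · simp [h₂, Ne.symm h₁]

theorem isClique_leftDescents : ∀ w : List V, Γ.IsClique (leftDescents Γ w : Set V)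
  | [] => by simp [leftDescents]
  | x :: w => by
    simp only [leftDescents, Finset.coe_insert, Finset.coe_filter]
    refine SimpleGraph.IsClique.insert ((isClique_leftDescents w).subset fun v hv => hv.1) ?_
    exact fun v hv _ => hv.2

end Words

/-! ### Counting reduced words by their left descents -/

section Counting

variable {V : Type*} [Fintype V] [DecidableEq V] (Γ : SimpleGraph V) [DecidableRel Γ.Adj]

/-- The reduced words of length `k`. -/
def reducedWords : ℕ → Finset (List V)
  | 0 => {[]}
  | k + 1 => ((reducedWords k).sigma fun w => (leftDescents Γ w)ᶜ).image fun p => p.2 :: p.1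

variable {Γ}

theorem mem_reducedWords {k : ℕ} {w : List V} :
    w ∈ reducedWords Γ k ↔ w.length = k ∧ IsReduced Γ w := by
  induction k generalizing w with
  | zero =>
    rw [reducedWords, Finset.mem_singleton, List.length_eq_zero_iff]
    exact ⟨fun h => ⟨h, h ▸ trivial⟩, fun h => h.1⟩
  | succ k ih =>
    cases w with
    | nil => simp [reducedWords]
    | cons v w =>
      simp only [reducedWords, Finset.mem_image, Finset.mem_sigma, Finset.mem_compl, ih,
        ← cancel_eq_none_iff, IsReduced, List.length_cons, Nat.add_right_cancel_iff,
        List.cons.injEq]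
      constructor
      · rintro ⟨⟨w', v'⟩, ⟨⟨h₁, h₂⟩, h₃⟩, rfl, rfl⟩
        exact ⟨h₁, h₃, h₂⟩
      · rintro ⟨h₁, h₃, h₂⟩
        exact ⟨⟨w, v⟩, ⟨⟨h₁, h₂⟩, h₃⟩, rfl, rfl⟩

theorem coeff_geodesicGrowthSeries (k : ℕ) :
    PowerSeries.coeff k (geodesicGrowthSeries (standardGenerator Γ)) =
      ((reducedWords Γ k).card : ℤ) := by
  have : {w : List V | w.length = k ∧ IsGeodesic (standardGenerator Γ) w} =
      (reducedWords Γ k : Set (List V)) := by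
    ext w
    simp [mem_reducedWords, isGeodesic_iff_isReduced]
  rw [geodesicGrowthSeries, PowerSeries.coeff_mk, this, Set.ncard_coe_finset]

/-- Summing a function of the number of left descents other than the first letter. -/
theorem sum_reducedWords_succ (k : ℕ) (f : ℤ → ℤ) :
    ∑ w ∈ reducedWords Γ (k + 1), f ((leftDescents Γ w).card - 1) =
      ∑ w ∈ reducedWords Γ k, ∑ v ∈ (leftDescents Γ w)ᶜ,
        f ((leftDescents Γ w).filter (Γ.Adj v)).card := by
  rw [reducedWords, Finset.sum_image, Finset.sum_sigma]
  · refine Finset.sum_congr rfl fun w _ => Finset.sum_congr rfl fun v hv => ?_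
    rw [leftDescents, Finset.card_insert_of_notMem (by simp)]
    simp
  · rintro ⟨w, v⟩ _ ⟨w', v'⟩ _ h
    simp only [List.cons.injEq] at h
    obtain ⟨rfl, rfl⟩ := h
    rfl

variable {n l q : ℕ} {σ : Finset V}

/-- Counts edges leaving the clique: each `a ∈ σ` has `l` neighbours, of which `|σ| - 1` lie in `σ`.
-/
theorem sum_compl_card_filter_adj (hl : Γ.IsRegularOfDegree l)
    (hσ : Γ.IsClique (σ : Set V)) :
    ∑ v ∈ σᶜ, ((σ.filter (Γ.Adj v)).card : ℤ) = σ.card * (l - (σ.card - 1)) := by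
  simp only [Finset.card_filter, Nat.cast_sum]
  rw [Finset.sum_comm, ← nsmul_eq_mul]
  refine Finset.sum_eq_card_nsmul fun a ha => ?_
  rw [← Nat.cast_sum, ← Finset.card_filter]
  have h₁ : σᶜ.filter (fun v => Γ.Adj v a) = Γ.neighborFinset a \ σ.erase a := by
    ext v
    simp only [Finset.mem_filter, Finset.mem_compl, Finset.mem_sdiff, Finset.mem_erase,
      SimpleGraph.mem_neighborFinset]
    refine ⟨fun h => ⟨h.2.symm, fun h' => h.1 h'.2⟩, fun h => ⟨fun h' => ?_, h.1.symm⟩⟩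
    exact h.2 ⟨h.1.ne', h'⟩
  have h₂ : σ.erase a ⊆ Γ.neighborFinset a := fun v hv => by
    rw [Finset.mem_erase] at hv
    exact (Γ.mem_neighborFinset a v).2 (hσ ha hv.2 hv.1.symm)
  have h₃ := Finset.card_sdiff_add_card_eq_card h₂
  rw [Γ.card_neighborFinset_eq_degree, hl a] at h₃
  have h₄ := Finset.card_erase_add_one ha
  rw [h₁]
  omega

/-- The same count with ordered pairs in `σ`: each is an edge with `q` common neighbours, of which
`|σ| - 2` lie in `σ`. -/
theorem sum_compl_card_filter_adj_mul_pred
    (hq : ∀ u v : V, Γ.Adj u v → (link Γ {u, v}).ncard = q) (hσ : Γ.IsClique (σ : Set V)) :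
    ∑ v ∈ σᶜ, ((σ.filter (Γ.Adj v)).card : ℤ) * ((σ.filter (Γ.Adj v)).card - 1) =
      σ.card * (σ.card - 1) * (q - (σ.card - 2)) := by
  have hoff (s : Finset V) : (s.card : ℤ) * (s.card - 1) = s.offDiag.card := by
    rw [Finset.offDiag_card, Nat.cast_sub (Nat.le_mul_self _)]
    push_cast
    ring
  have hfilter (v : V) : (σ.filter (Γ.Adj v)).offDiag =
      σ.offDiag.filter fun p => Γ.Adj v p.1 ∧ Γ.Adj v p.2 := by
    ext p
    simp only [Finset.mem_offDiag, Finset.mem_filter]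
    tauto
  simp only [hoff, hfilter]
  simp only [Finset.card_filter, Nat.cast_sum]
  rw [Finset.sum_comm, ← nsmul_eq_mul]
  refine Finset.sum_eq_card_nsmul fun p hp => ?_
  obtain ⟨ha, hb, hab⟩ := Finset.mem_offDiag.1 hp
  have hadj : Γ.Adj p.1 p.2 := hσ ha hb hab
  rw [← Nat.cast_sum, ← Finset.card_filter]
  set N : Finset V := Finset.univ.filter fun v => Γ.Adj p.1 v ∧ Γ.Adj p.2 v with hN
  have hNq : N.card = q := by
    rw [← hq _ _ hadj, ← Set.ncard_coe_finset]
    congr 1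
    ext v
    simp only [hN, link, Finset.coe_filter, Finset.mem_univ, true_and, Set.mem_ofPred_eq,
      Finset.mem_insert, Finset.mem_singleton, forall_eq_or_imp, forall_eq, not_or]
    exact ⟨fun h => ⟨⟨h.1.ne', h.2.ne'⟩, h⟩, fun h => h.2⟩
  have h₁ : σᶜ.filter (fun v => Γ.Adj v p.1 ∧ Γ.Adj v p.2) = N \ (σ.erase p.1).erase p.2 := by
    ext v
    simp only [hN, Finset.mem_filter, Finset.mem_compl, Finset.mem_sdiff, Finset.mem_erase,
      Finset.mem_univ, true_and]
    refine ⟨fun h => ⟨⟨h.2.1.symm, h.2.2.symm⟩, fun h' => h.1 h'.2.2⟩,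
      fun h => ⟨fun h' => ?_, h.1.1.symm, h.1.2.symm⟩⟩
    exact h.2 ⟨h.1.2.ne', h.1.1.ne', h'⟩
  have h₂ : (σ.erase p.1).erase p.2 ⊆ N := fun v hv => by
    simp only [Finset.mem_erase] at hv
    simp only [hN, Finset.mem_filter, Finset.mem_univ, true_and]
    exact ⟨hσ ha hv.2.2 hv.2.1.symm, hσ hb hv.2.2 hv.1.symm⟩
  have h₃ := Finset.card_sdiff_add_card_eq_card h₂
  have h₄ := Finset.card_erase_add_one ha
  have h₅ := Finset.card_erase_add_one (Finset.mem_erase.2 ⟨hab.symm, hb⟩)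
  rw [h₁]
  omega

variable (Γ)

/-- The sum over the reduced words of length `k + 1` of `f` of the number of left descents other
than the first letter, as a power series in `z`. -/
noncomputable def descentSeries (f : ℤ → ℤ) : PowerSeries ℤ :=
  PowerSeries.mk fun k => ∑ w ∈ reducedWords Γ (k + 1), f ((leftDescents Γ w).card - 1)

variable {Γ}

/-- A one-letter word has its only letter as descent, so `t = 0`. -/
theorem coeff_zero_descentSeries (f : ℤ → ℤ) :
    PowerSeries.coeff 0 (descentSeries Γ f) = Fintype.card V * f 0 := by
  rw [descentSeries, PowerSeries.coeff_mk, sum_reducedWords_succ 0 f]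
  simp [reducedWords, leftDescents]

theorem coeff_succ_descentSeries (k : ℕ) (f : ℤ → ℤ) :
    PowerSeries.coeff (k + 1) (descentSeries Γ f) =
      ∑ w ∈ reducedWords Γ (k + 1), ∑ v ∈ (leftDescents Γ w)ᶜ,
        f ((leftDescents Γ w).filter (Γ.Adj v)).card := by
  rw [descentSeries, PowerSeries.coeff_mk, sum_reducedWords_succ]

theorem geodesicGrowthSeries_sub_one :
    geodesicGrowthSeries (standardGenerator Γ) - 1 = z * descentSeries Γ fun _ => 1 := by
  ext k
  cases k with
  | zero =>
    simp only [map_sub, coeff_geodesicGrowthSeries]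
    simp [reducedWords]
  | succ k =>
    rw [PowerSeries.coeff_succ_X_mul, map_sub, coeff_geodesicGrowthSeries, descentSeries]
    simp [PowerSeries.coeff_one]

theorem leftDescents_card_mem (h4 : Γ.CliqueFree 4) {k : ℕ} {w : List V}
    (hw : w ∈ reducedWords Γ (k + 1)) :
    (leftDescents Γ w).card = 1 ∨ (leftDescents Γ w).card = 2 ∨ (leftDescents Γ w).card = 3 := by
  have h₁ : (leftDescents Γ w).card < 4 := by
    by_contra! h
    obtain ⟨t, ht, htc⟩ := Finset.exists_subset_card_eq h
    exact h4 t ⟨(isClique_leftDescents w).subset (Finset.coe_subset.2 ht), htc⟩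
  have h₂ : 0 < (leftDescents Γ w).card := by
    cases w with
    | nil => simp [mem_reducedWords] at hw
    | cons v w => exact Finset.card_pos.2 ⟨v, Finset.mem_insert_self _ _⟩
  omega

/-- A word has `n - |L| = (n - 1) - t` reduced extensions. -/
theorem descentSeries_one (hn : Fintype.card V = n) :
    descentSeries Γ (fun _ => 1) = n + z * ((n - 1) * descentSeries Γ (fun _ => 1) -
      descentSeries Γ fun t => t) := by
  have hC : (n : PowerSeries ℤ) = PowerSeries.C (n : ℤ) := by simp
  ext k
  cases k with
  | zero => simp [coeff_zero_descentSeries, hn, z]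
  | succ k =>
    rw [map_add, PowerSeries.coeff_succ_X_mul, sub_mul, one_mul, map_sub, map_sub, hC,
      PowerSeries.coeff_C_mul, PowerSeries.coeff_C]
    simp only [coeff_succ_descentSeries]
    simp only [descentSeries, PowerSeries.coeff_mk]
    rw [if_neg k.succ_ne_zero, zero_add, Finset.mul_sum, ← Finset.sum_sub_distrib,
      ← Finset.sum_sub_distrib]
    refine Finset.sum_congr rfl fun w _ => ?_
    have := Finset.card_add_card_compl (leftDescents Γ w)
    rw [Finset.sum_const, nsmul_one]
    omega

theorem descentSeries_id (hl : Γ.IsRegularOfDegree l) :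
    descentSeries Γ (fun t => t) = z * (l * descentSeries Γ (fun _ => 1) +
      (l - 2) * descentSeries Γ (fun t => t) - descentSeries Γ fun t => t * (t - 1)) := by
  have hC : (l : PowerSeries ℤ) = PowerSeries.C (l : ℤ) := by simp
  have hC' : (l - 2 : PowerSeries ℤ) = PowerSeries.C (l - 2 : ℤ) := by simp
  ext k
  cases k with
  | zero => simp [coeff_zero_descentSeries, z]
  | succ k =>
    rw [PowerSeries.coeff_succ_X_mul, map_sub, map_add, hC', hC,
      PowerSeries.coeff_C_mul, PowerSeries.coeff_C_mul]
    simp only [coeff_succ_descentSeries]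
    simp only [descentSeries, PowerSeries.coeff_mk]
    rw [Finset.mul_sum, Finset.mul_sum, ← Finset.sum_add_distrib, ← Finset.sum_sub_distrib]
    refine Finset.sum_congr rfl fun w _ => ?_
    rw [sum_compl_card_filter_adj hl (isClique_leftDescents w)]
    -- With `|L| = t + 1`: `(t+1)(l-t) = l + (l-2)t - t(t-1)`.
    ring

theorem descentSeries_mul_pred (h4 : Γ.CliqueFree 4)
    (hq : ∀ u v : V, Γ.Adj u v → (link Γ {u, v}).ncard = q) :
    descentSeries Γ (fun t => t * (t - 1)) = z * (2 * q * descentSeries Γ (fun t => t) +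
      (q - 3) * descentSeries Γ fun t => t * (t - 1)) := by
  have hC : (2 * q : PowerSeries ℤ) = PowerSeries.C (2 * q : ℤ) := by simp
  have hC' : (q - 3 : PowerSeries ℤ) = PowerSeries.C (q - 3 : ℤ) := by simp
  ext k
  cases k with
  | zero => simp [coeff_zero_descentSeries, z]
  | succ k =>
    rw [PowerSeries.coeff_succ_X_mul, map_add, hC', hC,
      PowerSeries.coeff_C_mul, PowerSeries.coeff_C_mul]
    simp only [coeff_succ_descentSeries]
    simp only [descentSeries, PowerSeries.coeff_mk]
    rw [Finset.mul_sum, Finset.mul_sum, ← Finset.sum_add_distrib]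
    refine Finset.sum_congr rfl fun w hw => ?_
    rw [sum_compl_card_filter_adj_mul_pred hq (isClique_leftDescents w)]
    -- `(t+1)t(q+1-t) = 2qt + (q-3)t(t-1)` is not a polynomial identity, but holds for `t = 0, 1,
    -- 2`.
    rcases leftDescents_card_mem h4 hw with h | h | h <;> rw [h] <;> push_cast <;> ring

end Counting

end RACG

-- `PowerSeries.invOfUnit D 1` is the inverse of a power series `D` with constant coefficient `1`.
theorem theorem1p1 {V : Type*} [Fintype V] [DecidableEq V] (Γ : SimpleGraph V)
    [DecidableRel Γ.Adj] (n l q : ℕ)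
    (hΓ : RACG.IsLinkRegular Γ)
    (hn : Fintype.card V = n)
    (hl : Γ.IsRegularOfDegree l)
    (hq : ∀ u v : V, Γ.Adj u v → (RACG.link Γ {u, v}).ncard = q)
    (h4 : Γ.CliqueFree 4) :
    RACG.geodesicGrowthSeries (RACG.standardGenerator Γ) - 1 =
      (n * RACG.z * (1 + (5 - l - q) * RACG.z
          + (l * q - 3 * l + 6) * RACG.z ^ 2) : PowerSeries ℤ) *
        PowerSeries.invOfUnit
          (1 + (6 - n - l - q) * RACG.z
            + (n * l + l * q + q * n - 5 * n - 3 * l - q + 11) * RACG.z ^ 2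
            + (3 * n * l + 6 - n * l * q - 6 * n) * RACG.z ^ 3 : PowerSeries ℤ) 1 := by
  have h₀ := RACG.descentSeries_one (Γ := Γ) hn
  have h₁ := RACG.descentSeries_id hl
  have h₂ := RACG.descentSeries_mul_pred h4 hq
  rw [RACG.geodesicGrowthSeries_sub_one]
  generalize RACG.descentSeries Γ (fun _ => 1) = B₀ at *
  generalize RACG.descentSeries Γ (fun t => t) = B₁ at *
  generalize RACG.descentSeries Γ (fun t => t * (t - 1)) = B₂ at *
  set D : PowerSeries ℤ := 1 + (6 - n - l - q) * RACG.z
    + (n * l + l * q + q * n - 5 * n - 3 * l - q + 11) * RACG.z ^ 2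
    + (3 * n * l + 6 - n * l * q - 6 * n) * RACG.z ^ 3 with hD
  have hinv : D * PowerSeries.invOfUnit D 1 = 1 :=
    PowerSeries.mul_invOfUnit D 1 (by simp [hD])
  have key : RACG.z * B₀ * D = n * RACG.z * (1 + (5 - l - q) * RACG.z
      + (l * q - 3 * l + 6) * RACG.z ^ 2) := by
    rw [hD]
    -- Cramer's rule for `B₀`: `D` is the determinant of the system, and the multipliers are `z`
    -- times the cofactors of the `B₀` column.
    linear_combination
      (1 + (5 - l - q) * RACG.z + (l * q - 3 * l + 6) * RACG.z ^ 2) * RACG.z * h₀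
        - RACG.z ^ 2 * (1 - (q - 3) * RACG.z) * h₁ + RACG.z ^ 3 * h₂
  rw [← key, mul_assoc, hinv, mul_one]
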